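/- Let $F$ be a field, let $\Omega$ be a set with maps $s,t\colon\Omega\to\mathbb Z_{\ge 0}$, and let $A$ be an $\Omega$-algebra, i.e. an $F$-vector space with a linear map $\omega_A\colon A^{\otimes s(\omega)}\to A^{\otimes t(\omega)}$ for every $\omega\in\Omega$ (where $A^{\otimes 0}=F$). All tensor products are over $F$. For a Hopf algebra $H$ over $F$ (antipode not assumed bijective), a \emph{coaction} of $H$ on $A$ is a linear map $\rho\colon A\to A\otimes H$, $\rho(a)=a_{(0)}\otimes a_{(1)}$, which makes $A$ a coassociative counital right $H$-comodule and satisfies $\rho_{t(\omega)}\circ\omega_A=(\omega_A\otimes \mathrm{id}_H)\circ\rho_{s(\omega)}$ for all $\omega\in\Omega$, where $\rho_0(\alpha)=\alpha 1_H$ and $$\rho_n(a_1\otimes\dots\otimes a_n)=(a_1)_{(0)}\otimes\dots\otimes (a_n)_{(0)}\otimes (a_1)_{(1)}\cdots (a_n)_{(1)}.$$ Its \emph{cosupport} is the subspace $\operatorname{cosupp}\rho=\{\,a\mapsto h^*(a_{(1)})\,a_{(0)} \mid h^*\in H^*\,\}$ of $\operatorname{End}_F(A)$. A subspace $V\subseteq\operatorname{End}_F(A)$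 is \emph{pointwise finite dimensional} if $Va=\{va\mid v\in V\}$ is finite dimensional for every $a\in A$. The Tambara universal coacting Hopf algebra $\mathcal H^\square(A,\operatorname{End}_F(A))$ is a Hopf algebra $\mathcal H$ with a coaction $\rho_{\mathcal H}\colon A\to A\otimes \mathcal H$ such that for every Hopf algebra $H$ and every coaction $\rho\colon A\to A\otimes H$ there is a unique Hopf algebra homomorphism $\varphi\colon\mathcal H\to H$ with $(\mathrm{id}_A\otimes\varphi)\rho_{\mathcal H}=\rho$; that is, an initial object in the category of all Hopf algebra coactions on $A$. Then $\mathcal H^\square(A,\operatorname{End}_F(A))$ exists if and only if the (unital) subalgebra of $\operatorname{End}_F(A)$ generated by $\operatorname{cosupp}\rho$, for all Hopf algebras $H$ and all coactions $\rho\colon A\to A\otimes H$, is pointwise finite dimensional. -/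

import Mathlib

open scoped TensorProduct

universe u v w x y

noncomputable section

namespace OmegaAlg

/-- An `Ω`-algebra structure on the vector space `A`, for a set `Ω` with source and target maps
`s t : Ω → ℕ`: a linear map `A^{⊗ s ω} → A^{⊗ t ω}` for every `ω`, with no further condition.
The power `⨂[F]^0 A` is the empty tensor power, canonically isomorphic to `F`. -/
abbrev Structure (F : Type u) [Field F] {Ω : Type w} (s t : Ω → ℕ)
    (A : Type v) [AddCommGroup A] [Module F A] : Type (max u v w) :=
  ∀ ω : Ω, (⨂[F]^(s ω) A) →ₗ[F] (⨂[F]^(t ω) A)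

section Comeasuring

variable {F : Type u} [Field F]
  {A : Type v} [AddCommGroup A] [Module F A]
  {B : Type y} [AddCommGroup B] [Module F B]

/-- The linear map `(B ⊗ Q)^{⊗ n} → B^{⊗ n} ⊗ Q`,
`(b₁ ⊗ q₁) ⊗ ⋯ ⊗ (bₙ ⊗ qₙ) ↦ (b₁ ⊗ ⋯ ⊗ bₙ) ⊗ q₁ ⋯ qₙ` (see `gather_tprod_tmul`), obtained by
multiplying in the algebra `T(B) ⊗ Q`, where `T(B)` is the tensor algebra, and then taking the
component of degree `n` in `T(B)`. -/
def gather (F : Type u) [Field F] (B : Type y) [AddCommGroup B] [Module F B]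
    (Q : Type x) [Ring Q] [Algebra F Q] (n : ℕ) :
    (⨂[F]^n (B ⊗[F] Q)) →ₗ[F] (⨂[F]^n B) ⊗[F] Q :=
  PiTensorProduct.lift
    ((LinearMap.rTensor Q
        (DirectSum.component F ℕ (fun i => ⨂[F]^i B) n ∘ₗ
          (TensorAlgebra.toDirectSum (R := F) (M := B)).toLinearMap)).compMultilinearMap
      ((MultilinearMap.mkPiAlgebraFin F n (TensorAlgebra F B ⊗[F] Q)).compLinearMap
        (fun _ => LinearMap.rTensor Q (TensorAlgebra.ι F (M := B)))))

theorem gather_tprod_tmul (Q : Type x) [Ring Q] [Algebra F Q] (n : ℕ)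
    (b : Fin n → B) (q : Fin n → Q) :
    gather F B Q n (PiTensorProduct.tprod F (fun i => b i ⊗ₜ[F] q i)) =
      PiTensorProduct.tprod F b ⊗ₜ[F] (List.ofFn q).prod := by
  have key : ∀ (m : ℕ) (b : Fin m → B) (q : Fin m → Q),
      (List.ofFn fun i => (TensorAlgebra.ι F (b i)) ⊗ₜ[F] (q i)).prod =
        (List.ofFn fun i => TensorAlgebra.ι F (b i)).prod ⊗ₜ[F] (List.ofFn q).prod := by
    intro m
    induction m with
    | zero => intro b q; simp [Algebra.TensorProduct.one_def]
    | succ m ih =>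
      intro b q
      simp [List.ofFn_succ, ih, Algebra.TensorProduct.tmul_mul_tmul]
  have h : (TensorAlgebra.toDirectSum (R := F) (M := B))
      (List.ofFn fun i => TensorAlgebra.ι F (b i)).prod =
        DirectSum.of (fun i => ⨂[F]^i B) n (PiTensorProduct.tprod F b) := by
    have := TensorAlgebra.toDirectSum_tensorPower_tprod (R := F) b
    rwa [TensorAlgebra.tprod_apply] at this
  have h2 : DirectSum.component F ℕ (fun i => ⨂[F]^i B) n
      (DirectSum.of (fun i => ⨂[F]^i B) n (PiTensorProduct.tprod F b)) =
        PiTensorProduct.tprod F b :=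
    DirectSum.of_eq_same (β := fun i => ⨂[F]^i B) n (PiTensorProduct.tprod F b)
  simp [gather, key, h, h2]

/-- The maps `ρ_n : A^{⊗ n} → B^{⊗ n} ⊗ Q` induced by `ρ : A → B ⊗ Q`:
`ρ_n (a₁ ⊗ ⋯ ⊗ aₙ) = (a₁)₍₀₎ ⊗ ⋯ ⊗ (aₙ)₍₀₎ ⊗ (a₁)₍₁₎ ⋯ (aₙ)₍₁₎`, and `ρ_0 α = α ⊗ 1`. -/
def tensorPowMap {Q : Type x} [Ring Q] [Algebra F Q] (ρ : A →ₗ[F] B ⊗[F] Q) (n : ℕ) :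
    (⨂[F]^n A) →ₗ[F] (⨂[F]^n B) ⊗[F] Q :=
  gather F B Q n ∘ₗ PiTensorProduct.map (fun _ : Fin n => ρ)

/-- A linear map `ρ : A → B ⊗ Q`, with `Q` a unital associative algebra, is a comeasuring between
the `Ω`-algebras `A` and `B` if it preserves all operations:
`ρ_{t ω} ∘ ω_A = (ω_B ⊗ id_Q) ∘ ρ_{s ω}`. -/
def IsComeasuring {Ω : Type w} {s t : Ω → ℕ} (opA : Structure F s t A) (opB : Structure F s t B)
    {Q : Type x} [Ring Q] [Algebra F Q] (ρ : A →ₗ[F] B ⊗[F] Q) : Prop :=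
  ∀ ω : Ω, tensorPowMap ρ (t ω) ∘ₗ opA ω =
    LinearMap.rTensor Q (opB ω) ∘ₗ tensorPowMap ρ (s ω)

/-- The map `Q* → Hom(A, B)`, `q* ↦ (a ↦ q*(a₍₁₎) a₍₀₎)`, attached to `ρ : A → B ⊗ Q`. -/
def coactDual {Q : Type x} [AddCommGroup Q] [Module F Q] (ρ : A →ₗ[F] B ⊗[F] Q) :
    Module.Dual F Q →ₗ[F] (A →ₗ[F] B) where
  toFun f := (TensorProduct.rid F B).toLinearMap ∘ₗ LinearMap.lTensor B f ∘ₗ ρ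
  map_add' f g := by ext a; simp [LinearMap.lTensor_add]
  map_smul' c f := by ext a; simp [LinearMap.lTensor_smul]

/-- The cosupport of `ρ : A → B ⊗ Q`: the space of all maps `a ↦ q*(a₍₁₎) a₍₀₎` with `q* ∈ Q*`. -/
def cosupp {Q : Type x} [AddCommGroup Q] [Module F Q] (ρ : A →ₗ[F] B ⊗[F] Q) :
    Submodule F (A →ₗ[F] B) :=
  LinearMap.range (coactDual ρ)

/-- A subspace `V` of `Hom(A, B)` is pointwise finite dimensional if `V a = {v a | v ∈ V}` is
finite dimensional for every `a ∈ A`. -/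
def PointwiseFiniteDimensional (V : Submodule F (A →ₗ[F] B)) : Prop :=
  ∀ a : A, FiniteDimensional F (V.map (LinearMap.applyₗ a))

end Comeasuring

section Coaction

variable {F : Type u} [Field F] {A : Type v} [AddCommGroup A] [Module F A]
  {Ω : Type w} {s t : Ω → ℕ}

/-- A coaction of the bialgebra `H` on the `Ω`-algebra `A`: a linear map `A → A ⊗ H` that makes `A`
a coassociative counital right `H`-comodule and that is a comeasuring from `A` to `A`. -/
structure IsCoaction (op : Structure F s t A) {H : Type x} [Ring H] [Bialgebra F H]
    (ρ : A →ₗ[F] A ⊗[F] H) : Prop where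
  coassoc : (TensorProduct.assoc F A H H).toLinearMap ∘ₗ LinearMap.rTensor H ρ ∘ₗ ρ =
    LinearMap.lTensor A (Coalgebra.comul (R := F) (A := H)) ∘ₗ ρ
  counit : ∀ a : A,
    TensorProduct.rid F A (LinearMap.lTensor A (Coalgebra.counit (R := F) (A := H)) (ρ a)) = a
  comeasuring : IsComeasuring op op ρ

/-- `(H, ρ)` is the `V`-universal coacting Hopf algebra of `A`: it is an initial object in the
category of Hopf algebra coactions on `A` with cosupport inside `V`. A homomorphism of Hopf
algebras is the same as a homomorphism of bialgebras. -/
structure IsUniversalCoactingHopf (op : Structure F s t A) (V : Subalgebra F (Module.End F A))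
    (H : Type x) [Ring H] [HopfAlgebra F H] (ρ : A →ₗ[F] A ⊗[F] H) : Prop where
  isCoaction : IsCoaction op ρ
  cosupp_le : cosupp ρ ≤ Subalgebra.toSubmodule V
  existsUnique : ∀ (H' : Type x) [Ring H'] [HopfAlgebra F H'] (ρ' : A →ₗ[F] A ⊗[F] H'),
    IsCoaction op ρ' → cosupp ρ' ≤ Subalgebra.toSubmodule V →
      ∃! φ : H →ₐc[F] H',
        LinearMap.lTensor A ((φ : H →ₐ[F] H').toLinearMap) ∘ₗ ρ = ρ'

/-- The `V`-universal coacting Hopf algebra of `A` exists (among Hopf algebras in the universe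
`x`). -/
def UniversalCoactingHopfExists (op : Structure F s t A) (V : Subalgebra F (Module.End F A)) :
    Prop :=
  ∃ (H : Type x) (_ : Ring H) (_ : HopfAlgebra F H) (ρ : A →ₗ[F] A ⊗[F] H),
    IsUniversalCoactingHopf op V H ρ

/-- The (unital) subalgebra of `End_F(A)` generated by the cosupports of all coactions on `A` of
all Hopf algebras (in the universe `x`). -/
def hopfCosuppAlgebra (op : Structure F s t A) : Subalgebra F (Module.End F A) :=
  Algebra.adjoin F
    {g | ∃ (H : Type x) (_ : Ring H) (_ : HopfAlgebra F H) (ρ : A →ₗ[F] A ⊗[F] H),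
      IsCoaction op ρ ∧ g ∈ cosupp ρ}

end Coaction

end OmegaAlg

end

/-! Necessity. If `(H, ρ)` is initial, every coaction is `(id ⊗ φ) ρ`, so its cosupport lies in that
of `ρ`. The latter is already a unital subalgebra, dual to the coalgebra structure of `H`, and it is
pointwise finite dimensional because each `ρ(a)` is a finite sum of pure tensors.

Sufficiency. Let `V` be the generated algebra. The antipode is built in from the start: a point over
an algebra `R` is an anti-endomorphism `S` and a comeasuring `ρ` with `ρ(a) ∈ Va ⊗ R` for which `S ∘
ρ` is a convolution inverse. `Univ` is the free algebra on symbols `Sⁿ((α ⊗ id) ρ(a))` modulo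
equality at all points. Finite dimensionality of `Va` makes the universal coaction a finite sum
(`exists_coact_apply`), so `Univ` carries a point itself (`isPoint`).

The crux is `algHom_ext`: an algebra map out of `Univ` is determined by its effect on the universal
comeasuring alone, because convolution inverses are unique. The tensor square of the universal point
then gives the comultiplication, the trivial point the counit, and the anti-endomorphism is the
antipode. Hopf coactions with cosupport in `V` are points, which gives initiality. -/

noncomputable section

namespace OmegaAlg

/-! ### Coefficients of tensors -/

section Coefficients

variable {F : Type*} [Field F] {W R R' : Type*} [AddCommGroup W] [Module F W]
  [AddCommGroup R] [Module F R] [AddCommGroup R'] [Module F R']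

/-- The coefficient `(α ⊗ id) z ∈ R` of `z ∈ W ⊗ R` with respect to a functional `α` on `W`. -/
def coef (α : Module.Dual F W) : W ⊗[F] R →ₗ[F] R :=
  (TensorProduct.lid F R).toLinearMap ∘ₗ LinearMap.rTensor R α

@[simp]
theorem coef_tmul (α : Module.Dual F W) (w : W) (r : R) : coef α (w ⊗ₜ[F] r) = α w • r := by
  simp [coef]

theorem coef_lTensor (α : Module.Dual F W) (f : R →ₗ[F] R') (z : W ⊗[F] R) :
    coef α (LinearMap.lTensor W f z) = f (coef α z) := by
  induction z with
  | zero => simp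
  | tmul w r => simp
  | add a b ha hb => simp only [map_add, ha, hb]

/-- The coordinate functionals of a basis of `W` already detect every tensor. -/
theorem eq_zero_of_coef {z : W ⊗[F] R} (h : ∀ α : Module.Dual F W, coef α z = 0) : z = 0 := by
  classical
  let b := Module.Basis.ofVectorSpace F W
  apply (TensorProduct.equivFinsuppOfBasisLeft b).injective
  ext i
  rw [TensorProduct.equivFinsuppOfBasisLeft_apply, map_zero]
  exact h (b.coord i)

theorem eq_of_coef {z z' : W ⊗[F] R} (h : ∀ α : Module.Dual F W, coef α z = coef α z') :
    z = z' :=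
  sub_eq_zero.1 <| eq_zero_of_coef fun α => by rw [map_sub, h, sub_self]

/-- An element of `W ⊗ R` is determined by its images under a jointly injective family of maps. -/
theorem eq_of_lTensor {ι : Type*} {Q : ι → Type*} [∀ i, AddCommGroup (Q i)]
    [∀ i, Module F (Q i)] (φ : ∀ i, R →ₗ[F] Q i) (hφ : ∀ r r', (∀ i, φ i r = φ i r') → r = r')
    {z z' : W ⊗[F] R} (h : ∀ i, LinearMap.lTensor W (φ i) z = LinearMap.lTensor W (φ i) z') :
    z = z' :=
  eq_of_coef fun α => hφ _ _ fun i => by rw [← coef_lTensor, h, coef_lTensor]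

theorem coef_coactDual (α : Module.Dual F W) (ρ : W →ₗ[F] W ⊗[F] R) (f : Module.Dual F R) (a : W) :
    f (coef α (ρ a)) = α (coactDual ρ f a) := by
  change _ = α (TensorProduct.rid F W (LinearMap.lTensor W f (ρ a)))
  induction ρ a with
  | zero => simp
  | tmul w r => simp [mul_comm]
  | add a b ha hb => simp only [map_add, ha, hb]

end Coefficients

/-! ### Convolution of maps `A → A ⊗ R` as composition of their `R`-linear extensions -/

section Extend

variable {F : Type*} [Field F] {A B C P Q R R' : Type*} [AddCommGroup A] [Module F A]
  [AddCommGroup B] [Module F B] [AddCommGroup C] [Module F C]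
  [Ring P] [Algebra F P] [Ring Q] [Algebra F Q] [Ring R] [Algebra F R] [Ring R'] [Algebra F R']

/-- The composite `A → B ⊗ Q → C ⊗ (P ⊗ Q)` of `ρ : A → B ⊗ Q` and `σ : B → C ⊗ P`. -/
def coComp (σ : B →ₗ[F] C ⊗[F] P) (ρ : A →ₗ[F] B ⊗[F] Q) : A →ₗ[F] C ⊗[F] (P ⊗[F] Q) :=
  (TensorProduct.assoc F C P Q).toLinearMap ∘ₗ LinearMap.rTensor Q σ ∘ₗ ρ

variable (F A R) in
/-- The trivial coaction `a ↦ a ⊗ 1`. -/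
def unitMap : A →ₗ[F] A ⊗[F] R := (TensorProduct.mk F A R).flip 1

@[simp]
theorem unitMap_apply (a : A) : unitMap F A R a = a ⊗ₜ[F] 1 := rfl

/-- The right `R`-linear extension `a ⊗ r ↦ ρ(a) r` of `ρ : A → A ⊗ R`. -/
def extend (ρ : A →ₗ[F] A ⊗[F] R) : A ⊗[F] R →ₗ[F] A ⊗[F] R :=
  LinearMap.lTensor A (LinearMap.mul' F R) ∘ₗ (TensorProduct.assoc F A R R).toLinearMap ∘ₗ
    LinearMap.rTensor R ρ

theorem extend_tmul (ρ : A →ₗ[F] A ⊗[F] R) (a : A) (r : R) :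
    extend ρ (a ⊗ₜ[F] r) = LinearMap.lTensor A (LinearMap.mulRight F r) (ρ a) := by
  simp only [extend, LinearMap.comp_apply, LinearMap.rTensor_tmul]
  induction ρ a with
  | zero => simp
  | tmul w r => simp
  | add a b ha hb => simp only [map_add, TensorProduct.add_tmul, ha, hb]

theorem extend_lTensor_mulRight (ρ : A →ₗ[F] A ⊗[F] R) (r : R) (z : A ⊗[F] R) :
    extend ρ (LinearMap.lTensor A (LinearMap.mulRight F r) z) =
      LinearMap.lTensor A (LinearMap.mulRight F r) (extend ρ z) := by
  induction z with
  | zero => simp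
  | tmul a q =>
    rw [LinearMap.lTensor_tmul, extend_tmul, extend_tmul, LinearMap.mulRight_apply,
      LinearMap.mulRight_mul, LinearMap.lTensor_comp_apply]
  | add a b ha hb => simp only [map_add, ha, hb]

theorem extend_comp_unitMap (ρ : A →ₗ[F] A ⊗[F] R) : extend ρ ∘ₗ unitMap F A R = ρ := by
  ext a
  simp [extend_tmul]

theorem extend_unitMap : extend (unitMap F A R) = LinearMap.id := by
  apply TensorProduct.ext'
  intro a r
  simp [extend_tmul]

/-- Maps `A → A ⊗ R` form a monoid under `extend ρ ∘ₗ σ` with unit `unitMap`; `extend` embeds it in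
the endomorphisms of `A ⊗ R`. -/
theorem extend_extend (ρ σ : A →ₗ[F] A ⊗[F] R) :
    extend (extend ρ ∘ₗ σ) = extend ρ ∘ₗ extend σ := by
  apply TensorProduct.ext'
  intro a r
  simp [extend_tmul, extend_lTensor_mulRight]

theorem extend_map (φ : R →ₐ[F] R') (ρ : A →ₗ[F] A ⊗[F] R) (z : A ⊗[F] R) :
    extend (LinearMap.lTensor A φ.toLinearMap ∘ₗ ρ) (LinearMap.lTensor A φ.toLinearMap z) =
      LinearMap.lTensor A φ.toLinearMap (extend ρ z) := by
  induction z with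
  | zero => simp
  | tmul a q =>
    rw [LinearMap.lTensor_tmul, extend_tmul, extend_tmul, LinearMap.comp_apply,
      ← LinearMap.lTensor_comp_apply, ← LinearMap.lTensor_comp_apply]
    congr 2
    ext
    simp
  | add a b ha hb => simp only [map_add, ha, hb]

/-- In a monoid a left inverse and a right inverse of the same element coincide. -/
theorem eq_of_extend_comp {ρ σ σ' : A →ₗ[F] A ⊗[F] R} (h : extend ρ ∘ₗ σ = unitMap F A R)
    (h' : extend σ' ∘ₗ ρ = unitMap F A R) : σ' = σ := by
  rw [← extend_comp_unitMap σ', ← h, ← LinearMap.comp_assoc, ← extend_extend, h', extend_unitMap,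
    LinearMap.id_comp]

end Extend

/-! ### Functoriality and composition of comeasurings -/

section Comeasuring

variable {F : Type u} [Field F] {A : Type v} [AddCommGroup A] [Module F A]
  {B : Type y} [AddCommGroup B] [Module F B] {C : Type w} [AddCommGroup C] [Module F C]
  {P Q R R' : Type*}
  [Ring P] [Algebra F P] [Ring Q] [Algebra F Q] [Ring R] [Algebra F R] [Ring R'] [Algebra F R']

theorem tensorPow_ext {n : ℕ} {M : Type*} [AddCommGroup M] [Module F M]
    {f g : (⨂[F]^n (B ⊗[F] Q)) →ₗ[F] M}
    (h : ∀ (b : Fin n → B) (q : Fin n → Q),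
      f (PiTensorProduct.tprod F fun i => b i ⊗ₜ[F] q i) =
        g (PiTensorProduct.tprod F fun i => b i ⊗ₜ[F] q i)) : f = g := by
  apply PiTensorProduct.ext
  refine MultilinearMap.ext_of_span_eq_top
    (g := fun (_ : Fin n) (p : B × Q) => p.1 ⊗ₜ[F] p.2) (fun _ => ?_) ?_
  · rw [eq_top_iff, ← TensorProduct.span_tmul_eq_top F B Q]
    apply Submodule.span_mono
    rintro _ ⟨b, q, rfl⟩
    exact ⟨(b, q), rfl⟩
  · intro p
    exact h (fun i => (p i).1) (fun i => (p i).2)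

theorem gather_map (φ : R →ₐ[F] R') (n : ℕ) :
    gather F B R' n ∘ₗ PiTensorProduct.map (fun _ => LinearMap.lTensor B φ.toLinearMap) =
      LinearMap.lTensor (⨂[F]^n B) φ.toLinearMap ∘ₗ gather F B R n := by
  apply tensorPow_ext
  intro b q
  simp only [LinearMap.comp_apply, PiTensorProduct.map_tprod, LinearMap.lTensor_tmul,
    gather_tprod_tmul]
  congr 1
  simp [map_list_prod, List.map_ofFn]
  rfl

theorem tensorPowMap_map (φ : R →ₐ[F] R') (ρ : A →ₗ[F] B ⊗[F] R) (n : ℕ) :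
    tensorPowMap (LinearMap.lTensor B φ.toLinearMap ∘ₗ ρ) n =
      LinearMap.lTensor (⨂[F]^n B) φ.toLinearMap ∘ₗ tensorPowMap ρ n := by
  rw [tensorPowMap, tensorPowMap, PiTensorProduct.map_comp, ← LinearMap.comp_assoc, gather_map,
    LinearMap.comp_assoc]

theorem tensorPowMap_unitMap (n : ℕ) :
    tensorPowMap (unitMap F A R) n = unitMap F (⨂[F]^n A) R := by
  apply PiTensorProduct.ext
  ext a
  have := gather_tprod_tmul (F := F) R n a (fun _ => 1)
  simp only [tensorPowMap, LinearMap.compMultilinearMap_apply, LinearMap.comp_apply,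
    PiTensorProduct.map_tprod, unitMap_apply]
  rw [this]
  simp

/-- `gather` for `C ⊗ (P ⊗ Q)` is obtained by gathering first the factors in `Q`, then those
in `P`. -/
theorem gather_coComp (σ : B →ₗ[F] C ⊗[F] P) (n : ℕ) :
    gather F C (P ⊗[F] Q) n ∘ₗ PiTensorProduct.map
      (fun _ => (TensorProduct.assoc F C P Q).toLinearMap ∘ₗ LinearMap.rTensor Q σ) =
      (TensorProduct.assoc F (⨂[F]^n C) P Q).toLinearMap ∘ₗ
        LinearMap.rTensor Q (tensorPowMap σ n) ∘ₗ gather F B Q n := by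
  apply tensorPow_ext
  intro b q
  have key : gather F C (P ⊗[F] Q) n ∘ₗ PiTensorProduct.map
      (fun i => (TensorProduct.assoc F C P Q).toLinearMap ∘ₗ
        (TensorProduct.mk F (C ⊗[F] P) Q).flip (q i)) =
      (TensorProduct.assoc F (⨂[F]^n C) P Q).toLinearMap ∘ₗ
        (TensorProduct.mk F ((⨂[F]^n C) ⊗[F] P) Q).flip (List.ofFn q).prod ∘ₗ
          gather F C P n := by
    apply tensorPow_ext
    intro c p
    have h : ∀ (m : ℕ) (p : Fin m → P) (q : Fin m → Q),
        (List.ofFn fun i => p i ⊗ₜ[F] q i).prod =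
          (List.ofFn p).prod ⊗ₜ[F] (List.ofFn q).prod := by
      intro m
      induction m with
      | zero => intro p q; simp [Algebra.TensorProduct.one_def]
      | succ m ih => intro p q; simp [List.ofFn_succ, ih]
    simp only [LinearMap.comp_apply, PiTensorProduct.map_tprod, LinearMap.flip_apply,
      TensorProduct.mk_apply, LinearEquiv.coe_coe, TensorProduct.assoc_tmul, gather_tprod_tmul, h]
  have := LinearMap.congr_fun key (PiTensorProduct.tprod F fun i => σ (b i))
  simpa [gather_tprod_tmul, tensorPowMap] using this

theorem tensorPowMap_coComp (σ : B →ₗ[F] C ⊗[F] P) (ρ : A →ₗ[F] B ⊗[F] Q) (n : ℕ) :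
    tensorPowMap (coComp σ ρ) n = coComp (tensorPowMap σ n) (tensorPowMap ρ n) := by
  rw [coComp, coComp, tensorPowMap, ← LinearMap.comp_assoc, PiTensorProduct.map_comp,
    ← LinearMap.comp_assoc, gather_coComp, LinearMap.comp_assoc, LinearMap.comp_assoc]
  rfl

variable {Ω : Type*} {s t : Ω → ℕ} {opA : Structure F s t A} {opB : Structure F s t B}
  {opC : Structure F s t C}

theorem IsComeasuring.coComp {σ : B →ₗ[F] C ⊗[F] P} {ρ : A →ₗ[F] B ⊗[F] Q}
    (hσ : IsComeasuring opB opC σ) (hρ : IsComeasuring opA opB ρ) :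
    IsComeasuring opA opC (coComp σ ρ) := by
  intro ω
  rw [tensorPowMap_coComp, tensorPowMap_coComp]
  ext1
  ext a
  have h1 := LinearMap.congr_fun (hρ ω) (PiTensorProduct.tprod F a)
  simp only [LinearMap.comp_apply] at h1
  simp only [OmegaAlg.coComp, LinearMap.compMultilinearMap_apply, LinearMap.comp_apply, h1]
  induction tensorPowMap ρ (s ω) (PiTensorProduct.tprod F a) with
  | zero => simp
  | tmul b q =>
    have h2 := LinearMap.congr_fun (hσ ω) b
    simp only [LinearMap.comp_apply] at h2
    simp only [LinearMap.rTensor_tmul, h2]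
    induction tensorPowMap σ (s ω) b with
    | zero => simp
    | tmul c p => simp
    | add a b ha hb => simp only [map_add, TensorProduct.add_tmul, ha, hb]
  | add a b ha hb => simp only [map_add, ha, hb]

theorem isComeasuring_unitMap : IsComeasuring opA opA (unitMap F A R) := by
  intro ω
  rw [tensorPowMap_unitMap, tensorPowMap_unitMap]
  ext1
  ext a
  simp

end Comeasuring

/-! ### Points and the algebra that represents them -/

section Points

variable {F : Type u} [Field F] {A : Type v} [AddCommGroup A] [Module F A]
  {Ω : Type w} {s t : Ω → ℕ}

/-- A coaction-like datum over an algebra `R`: an anti-endomorphism `S` of `R` and a comeasuring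
`ρ : A → A ⊗ R` with coefficients controlled by `V`, for which `S ∘ ρ` is a convolution inverse. -/
structure IsPoint (op : Structure F s t A) (V : Subalgebra F (Module.End F A)) {R : Type y} [Ring R]
    [Algebra F R] (S : R →ₗ[F] R) (ρ : A →ₗ[F] A ⊗[F] R) : Prop where
  map_one : S 1 = 1
  map_mul : ∀ a b, S (a * b) = S b * S a
  coef_eq_zero : ∀ (a : A) (α : Module.Dual F A), (∀ v ∈ V, α (v a) = 0) → coef α (ρ a) = 0
  comeasuring : IsComeasuring op op ρ
  right_inv : extend ρ ∘ₗ LinearMap.lTensor A S ∘ₗ ρ = unitMap F A R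
  left_inv : extend (LinearMap.lTensor A S ∘ₗ ρ) ∘ₗ ρ = unitMap F A R

/-- The anti-endomorphism of a point as a homomorphism to the opposite algebra. -/
def IsPoint.opHom {op : Structure F s t A} {V : Subalgebra F (Module.End F A)} {R : Type y}
    [Ring R] [Algebra F R] {S : R →ₗ[F] R} {ρ : A →ₗ[F] A ⊗[F] R} (h : IsPoint op V S ρ) :
    R →ₐ[F] Rᵐᵒᵖ :=
  AlgHom.ofLinearMap ((MulOpposite.opLinearEquiv F).toLinearMap ∘ₗ S)
    (by simp [h.map_one]) (by simp [h.map_mul])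

/-- Bundled points over algebras in a fixed universe. -/
structure Point (op : Structure F s t A) (V : Subalgebra F (Module.End F A)) where
  /-- The underlying algebra. -/
  carrier : Type (max u v x)
  [ring : Ring carrier]
  [algebra : Algebra F carrier]
  /-- The anti-endomorphism. -/
  anti : carrier →ₗ[F] carrier
  /-- The comeasuring. -/
  coact : A →ₗ[F] A ⊗[F] carrier
  isPoint : IsPoint op V anti coact

attribute [instance] Point.ring Point.algebra

variable (F A) in
/-- Indices `(n, α, a)` for the elements `Sⁿ ((α ⊗ id) (ρ a))`. -/
abbrev Gen : Type (max u v x) := ULift.{x} (ℕ × Module.Dual F A × A)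

/-- Evaluation at a pair `(S, ρ)` of the free algebra on the symbols `Sⁿ ((α ⊗ id) (ρ a))`. -/
def evalFree {R : Type y} [Ring R] [Algebra F R] (S : R →ₗ[F] R) (ρ : A →ₗ[F] A ⊗[F] R) :
    FreeAlgebra F (Gen.{u, v, x} F A) →ₐ[F] R :=
  FreeAlgebra.lift F fun g => (S ^ g.down.1) (coef g.down.2.1 (ρ g.down.2.2))

/-- Two elements are identified if they take equal values at all points. -/
def PointRel (op : Structure F s t A) (V : Subalgebra F (Module.End F A))
    (a b : FreeAlgebra F (Gen.{u, v, x} F A)) : Prop :=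
  ∀ p : Point.{u, v, w, x} op V, evalFree p.anti p.coact a = evalFree p.anti p.coact b

/-- The algebra representing points. -/
def Univ (op : Structure F s t A) (V : Subalgebra F (Module.End F A)) : Type (max u v x) :=
  RingQuot (PointRel.{u, v, w, x} op V)

variable {op : Structure F s t A} {V : Subalgebra F (Module.End F A)}

instance : Ring (Univ.{u, v, w, x} op V) :=
  inferInstanceAs (Ring (RingQuot (PointRel.{u, v, w, x} op V)))

instance : Algebra F (Univ.{u, v, w, x} op V) :=
  inferInstanceAs (Algebra F (RingQuot (PointRel.{u, v, w, x} op V)))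

namespace Univ

variable (op V) in
/-- The quotient map from the free algebra. -/
def mk : FreeAlgebra F (Gen.{u, v, x} F A) →ₐ[F] Univ.{u, v, w, x} op V :=
  RingQuot.mkAlgHom F (PointRel.{u, v, w, x} op V)

theorem mk_surjective : Function.Surjective (mk.{u, v, w, x} op V) :=
  RingQuot.mkAlgHom_surjective F _

/-- The homomorphism classifying a point. -/
def eval (p : Point.{u, v, w, x} op V) : Univ.{u, v, w, x} op V →ₐ[F] p.carrier :=
  RingQuot.liftAlgHom F ⟨evalFree p.anti p.coact, fun _ _ h => h p⟩

theorem eval_mk (p : Point.{u, v, w, x} op V) (a : FreeAlgebra F (Gen.{u, v, x} F A)) :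
    eval p (mk op V a) = evalFree p.anti p.coact a :=
  RingQuot.liftAlgHom_mkAlgHom_apply F _ _ a

theorem ext_eval {a b : Univ.{u, v, w, x} op V} (h : ∀ p, eval p a = eval p b) : a = b := by
  obtain ⟨a, rfl⟩ := mk_surjective a
  obtain ⟨b, rfl⟩ := mk_surjective b
  exact RingQuot.mkAlgHom_rel F fun p => by simpa only [eval_mk] using h p

theorem ext_lTensor {M : Type*} [AddCommGroup M] [Module F M]
    {z z' : M ⊗[F] Univ.{u, v, w, x} op V}
    (h : ∀ p, LinearMap.lTensor M (eval p).toLinearMap z =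
      LinearMap.lTensor M (eval p).toLinearMap z') : z = z' :=
  eq_of_lTensor (fun p => (eval p).toLinearMap) (fun _ _ h => ext_eval h) h

/-- The shift `Sⁿ ↦ Sⁿ⁺¹` on the free algebra. -/
def shift : FreeAlgebra F (Gen.{u, v, x} F A) →ₐ[F] (FreeAlgebra F (Gen.{u, v, x} F A))ᵐᵒᵖ :=
  FreeAlgebra.lift F fun g => MulOpposite.op (FreeAlgebra.ι F ⟨(g.down.1 + 1, g.down.2)⟩)

/-- Both sides are algebra maps into the opposite algebra that agree on generators. Consequently the
shift respects `PointRel` and descends to the quotient. -/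
theorem evalFree_shift (p : Point.{u, v, w, x} op V) (a : FreeAlgebra F (Gen.{u, v, x} F A)) :
    evalFree p.anti p.coact (shift a).unop = p.anti (evalFree p.anti p.coact a) := by
  have : (AlgHom.op (evalFree p.anti p.coact)).comp shift =
      p.isPoint.opHom.comp (evalFree.{u, v, x} p.anti p.coact) := by
    ext g
    simp [shift, evalFree, IsPoint.opHom, pow_succ']
    rfl
  exact congrArg MulOpposite.unop (AlgHom.congr_fun this a)

variable (op V) in
/-- The anti-endomorphism of the universal algebra, as a homomorphism to the opposite algebra. -/
def antiHom : Univ.{u, v, w, x} op V →ₐ[F] (Univ.{u, v, w, x} op V)ᵐᵒᵖ :=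
  RingQuot.liftAlgHom F ⟨(AlgHom.op (mk op V)).comp shift, fun a b h => by
    apply MulOpposite.unop_injective
    apply RingQuot.mkAlgHom_rel F
    intro p
    exact (evalFree_shift p a).trans ((congrArg p.anti (h p)).trans (evalFree_shift p b).symm)⟩

variable (op V) in
/-- The anti-endomorphism of the universal algebra. -/
def anti : Univ.{u, v, w, x} op V →ₗ[F] Univ.{u, v, w, x} op V :=
  (MulOpposite.opLinearEquiv F).symm.toLinearMap ∘ₗ (antiHom op V).toLinearMap

theorem anti_apply (a : Univ.{u, v, w, x} op V) : anti op V a = (antiHom op V a).unop := rfl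

theorem anti_mk (a : FreeAlgebra F (Gen.{u, v, x} F A)) :
    anti op V (mk.{u, v, w, x} op V a) = mk op V (shift a).unop :=
  congrArg MulOpposite.unop (RingQuot.liftAlgHom_mkAlgHom_apply F _ _ a)

theorem anti_one : anti.{u, v, w, x} op V 1 = 1 := by simp [anti_apply]

theorem anti_mul (a b : Univ.{u, v, w, x} op V) :
    anti op V (a * b) = anti op V b * anti op V a := by simp [anti_apply]

theorem eval_anti (p : Point.{u, v, w, x} op V) (a : Univ.{u, v, w, x} op V) :
    eval p (anti op V a) = p.anti (eval p a) := by
  obtain ⟨a, rfl⟩ := mk_surjective a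
  rw [anti_mk, eval_mk, eval_mk, evalFree_shift]

variable (op V) in
/-- The universal coefficient `(α ⊗ id) (ρ a)`. -/
def gen (α : Module.Dual F A) (a : A) : Univ.{u, v, w, x} op V :=
  mk op V (FreeAlgebra.ι F ⟨(0, α, a)⟩)

theorem eval_gen (p : Point.{u, v, w, x} op V) (α : Module.Dual F A) (a : A) :
    eval p (gen op V α a) = coef α (p.coact a) := by
  simp [gen, eval_mk, evalFree]

theorem mk_ι (g : Gen.{u, v, x} F A) :
    mk.{u, v, w, x} op V (FreeAlgebra.ι F g) =
      (anti op V ^ g.down.1) (gen op V g.down.2.1 g.down.2.2) := by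
  obtain ⟨n, α, a⟩ := g
  dsimp only
  induction n with
  | zero => simp [gen]
  | succ n ih =>
    rw [pow_succ', Module.End.mul_apply, ← ih, anti_mk]
    simp [shift]

/-- The coordinate functionals of a finite basis of `Va` are extended to all of `A`. -/
theorem exists_coordinates (hV : PointwiseFiniteDimensional (Subalgebra.toSubmodule V)) (a : A) :
    ∃ (n : ℕ) (e : Fin n → A) (E : Fin n → Module.Dual F A),
      ∀ v ∈ V, v a = ∑ i, E i (v a) • e i := by
  have := hV a
  let b := Module.finBasis F ((Subalgebra.toSubmodule V).map (LinearMap.applyₗ a))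
  choose E hE using fun i => LinearMap.exists_extend (b.coord i)
  refine ⟨_, fun i => b i, E, fun v hv => ?_⟩
  have hmem : v a ∈ (Subalgebra.toSubmodule V).map (LinearMap.applyₗ a) := ⟨v, hv, rfl⟩
  have h := congrArg Subtype.val (b.sum_repr ⟨v a, hmem⟩)
  simp only [AddSubmonoidClass.coe_finsetSum, SetLike.val_smul] at h
  refine h.symm.trans (Finset.sum_congr rfl fun i _ => ?_)
  rw [← b.coord_apply, ← hE i]
  rfl

/-- Every point has `ρ(a) ∈ Va ⊗ R`, so one finite sum `∑ eᵢ ⊗ gen Eᵢ a`, chosen independently of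
the point, specializes to all the `ρ(a)`. -/
theorem exists_coact_apply (hV : PointwiseFiniteDimensional (Subalgebra.toSubmodule V)) (a : A) :
    ∃ z : A ⊗[F] Univ.{u, v, w, x} op V, ∀ p,
      LinearMap.lTensor A (eval p).toLinearMap z = p.coact a := by
  obtain ⟨n, e, E, h⟩ := exists_coordinates hV a
  refine ⟨∑ i, e i ⊗ₜ[F] gen op V (E i) a, fun p => eq_of_coef fun α => ?_⟩
  -- This functional vanishes on `Va`, where the `E i` are the coordinates with respect to the `e
  -- i`.
  have := p.isPoint.coef_eq_zero a (α - ∑ i, α (e i) • E i) fun v hv => by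
    rw [LinearMap.sub_apply, sub_eq_zero]
    refine (congrArg α (h v hv)).trans ?_
    simp only [map_sum, map_smul, LinearMap.sum_apply, LinearMap.smul_apply, smul_eq_mul, mul_comm]
  have hlin : coef (R := p.carrier) (α - ∑ i, α (e i) • E i) =
      coef α - ∑ i, α (e i) • coef (E i) := by
    apply TensorProduct.ext'
    intro a r
    simp [sub_smul, Finset.sum_smul, mul_smul]
  rw [hlin, LinearMap.sub_apply, sub_eq_zero] at this
  rw [this]
  simp [eval_gen]

variable (op) in
/-- The universal comeasuring. -/
def coact (hV : PointwiseFiniteDimensional (Subalgebra.toSubmodule V)) :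
    A →ₗ[F] A ⊗[F] Univ.{u, v, w, x} op V where
  toFun a := (exists_coact_apply hV a).choose
  map_add' a b := ext_lTensor fun p => by
    have h := fun c => (exists_coact_apply.{u, v, w, x} (op := op) hV c).choose_spec p
    rw [map_add, h, h, h, map_add]
  map_smul' c a := ext_lTensor fun p => by
    have h := fun c => (exists_coact_apply.{u, v, w, x} (op := op) hV c).choose_spec p
    rw [map_smul, h, h, map_smul, RingHom.id_apply]

variable (hV : PointwiseFiniteDimensional (Subalgebra.toSubmodule V))

theorem eval_coact (p : Point.{u, v, w, x} op V) :
    LinearMap.lTensor A (eval p).toLinearMap ∘ₗ coact op hV = p.coact := by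
  ext a
  exact (exists_coact_apply hV a).choose_spec p

theorem coef_coact (α : Module.Dual F A) (a : A) :
    coef α (coact.{u, v, w, x} op hV a) = gen op V α a := by
  apply ext_eval
  intro p
  rw [eval_gen, ← eval_coact hV p, LinearMap.comp_apply, coef_lTensor]
  rfl

theorem eval_anti_coact (p : Point.{u, v, w, x} op V) :
    LinearMap.lTensor A (eval p).toLinearMap ∘ₗ LinearMap.lTensor A (anti op V) ∘ₗ coact op hV =
      LinearMap.lTensor A p.anti ∘ₗ p.coact := by
  rw [← eval_coact hV p, ← LinearMap.comp_assoc, ← LinearMap.comp_assoc, ← LinearMap.lTensor_comp,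
    ← LinearMap.lTensor_comp]
  congr 2
  ext a
  exact eval_anti p a

/-- Points jointly separate `Univ`, also after tensoring with a vector space, so each axiom can be
checked at every point, where it holds by assumption. -/
theorem isPoint : IsPoint op V (anti.{u, v, w, x} op V) (coact op hV) where
  map_one := anti_one
  map_mul := anti_mul
  coef_eq_zero a α h := ext_eval fun p => by
    rw [coef_coact, eval_gen, p.isPoint.coef_eq_zero a α h, map_zero]
  comeasuring ω := by
    apply LinearMap.ext
    intro z
    apply ext_lTensor
    intro p
    have h := fun n => tensorPowMap_map (eval p) (coact op hV) n
    simp only [eval_coact] at h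
    have h2 := LinearMap.congr_fun (p.isPoint.comeasuring ω) z
    simp only [h, LinearMap.comp_apply] at h2
    simp only [LinearMap.comp_apply, h2]
    rw [← LinearMap.comp_apply (LinearMap.rTensor _ _), LinearMap.rTensor_comp_lTensor,
      ← LinearMap.lTensor_comp_rTensor, LinearMap.comp_apply]
  right_inv := by
    ext a
    apply ext_lTensor
    intro p
    have := LinearMap.congr_fun p.isPoint.right_inv a
    rw [← eval_anti_coact hV p] at this
    simp only [LinearMap.comp_apply] at this
    rw [← eval_coact hV p, extend_map] at this
    simpa using this
  left_inv := by
    ext a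
    apply ext_lTensor
    intro p
    have := LinearMap.congr_fun p.isPoint.left_inv a
    rw [← eval_anti_coact hV p, ← eval_coact hV p] at this
    simp only [LinearMap.comp_apply] at this
    rw [extend_map] at this
    simpa using this

/-- The images of `S ∘ ρ` under `φ` and `ψ` are convolution inverses of the same map, hence equal.
Neither homomorphism has to respect an anti-endomorphism. -/
theorem algHom_ext_anti {R : Type y} [Ring R] [Algebra F R] (φ ψ : Univ.{u, v, w, x} op V →ₐ[F] R)
    (h : LinearMap.lTensor A φ.toLinearMap ∘ₗ coact op hV =
      LinearMap.lTensor A ψ.toLinearMap ∘ₗ coact op hV) :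
    LinearMap.lTensor A φ.toLinearMap ∘ₗ LinearMap.lTensor A (anti op V) ∘ₗ coact op hV =
      LinearMap.lTensor A ψ.toLinearMap ∘ₗ LinearMap.lTensor A (anti op V) ∘ₗ coact op hV := by
  apply eq_of_extend_comp (ρ := LinearMap.lTensor A ψ.toLinearMap ∘ₗ coact op hV)
  · ext a
    have := LinearMap.congr_fun (isPoint (op := op) hV).right_inv a
    simp only [LinearMap.comp_apply] at this
    simp only [LinearMap.comp_apply]
    rw [extend_map, this]
    simp
  · rw [← h]
    ext a
    have := LinearMap.congr_fun (isPoint (op := op) hV).left_inv a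
    simp only [LinearMap.comp_apply] at this
    simp only [LinearMap.comp_apply]
    rw [extend_map, this]
    simp

/-- Precomposing with `S` turns `φ` and `ψ` into homomorphisms to `Rᵐᵒᵖ` that satisfy the same
hypothesis by `algHom_ext_anti`. This lowers `n` by one, so the induction must let the target vary.
-/
theorem algHom_eq_on_gen (n : ℕ) {R : Type y} [Ring R] [Algebra F R]
    (φ ψ : Univ.{u, v, w, x} op V →ₐ[F] R)
    (h : LinearMap.lTensor A φ.toLinearMap ∘ₗ coact op hV =
      LinearMap.lTensor A ψ.toLinearMap ∘ₗ coact op hV) (α : Module.Dual F A) (a : A) :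
    φ ((anti op V ^ n) (gen op V α a)) = ψ ((anti op V ^ n) (gen op V α a)) := by
  induction n generalizing R with
  | zero =>
    have := congrArg (coef α) (LinearMap.congr_fun h a)
    simp only [LinearMap.comp_apply, coef_lTensor, coef_coact] at this
    exact this
  | succ n ih =>
    have := ih ((AlgHom.op φ).comp (antiHom op V)) ((AlgHom.op ψ).comp (antiHom op V)) (by
      have h2 := congrArg (LinearMap.comp (LinearMap.lTensor A
        (MulOpposite.opLinearEquiv F : R ≃ₗ[F] Rᵐᵒᵖ).toLinearMap)) (algHom_ext_anti hV φ ψ h)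
      simp only [← LinearMap.comp_assoc, ← LinearMap.lTensor_comp] at h2
      exact h2)
    rw [pow_succ', Module.End.mul_apply]
    exact congrArg MulOpposite.unop this

theorem algHom_ext {R : Type y} [Ring R] [Algebra F R] {φ ψ : Univ.{u, v, w, x} op V →ₐ[F] R}
    (h : LinearMap.lTensor A φ.toLinearMap ∘ₗ coact op hV =
      LinearMap.lTensor A ψ.toLinearMap ∘ₗ coact op hV) : φ = ψ := by
  have : φ.comp (mk op V) = ψ.comp (mk op V) := by
    ext g
    simp only [Function.comp_apply, AlgHom.coe_comp, mk_ι]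
    exact algHom_eq_on_gen hV _ φ ψ h _ _
  ext a
  obtain ⟨a, rfl⟩ := mk_surjective a
  exact AlgHom.congr_fun this a

/-- A subalgebra that contains the coefficients of the universal comeasuring and is stable under
the anti-endomorphism is everything. -/
theorem mem_of_gen {E : Subalgebra F (Univ.{u, v, w, x} op V)} (hg : ∀ α a, gen op V α a ∈ E)
    (hS : ∀ a ∈ E, anti op V a ∈ E) (a : Univ.{u, v, w, x} op V) : a ∈ E := by
  have h : ∀ (n : ℕ) α a, (anti op V ^ n) (gen op V α a) ∈ E := by
    intro n α a
    induction n with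
    | zero => exact hg α a
    | succ n ih => rw [pow_succ', Module.End.mul_apply]; exact hS _ ih
  obtain ⟨a, rfl⟩ := mk_surjective a
  induction a using FreeAlgebra.induction with
  | grade0 r => rw [AlgHom.commutes]; exact E.algebraMap_mem r
  | grade1 g => rw [mk_ι]; exact h _ _ _
  | mul a b ha hb => rw [map_mul]; exact E.mul_mem ha hb
  | add a b ha hb => rw [map_add]; exact E.add_mem ha hb

end Univ

end Points

/-! ### Calculus of the composition `coComp` -/

section CoComp

variable {F : Type*} [Field F] {A B C D P P' Q Q' R R' : Type*} [AddCommGroup A] [Module F A]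
  [AddCommGroup B] [Module F B] [AddCommGroup C] [Module F C] [AddCommGroup D] [Module F D]
  [Ring P] [Algebra F P] [Ring P'] [Algebra F P'] [Ring Q] [Algebra F Q] [Ring Q'] [Algebra F Q']
  [Ring R] [Algebra F R] [Ring R'] [Algebra F R']

theorem lTensor_rTensor_coComp (f : P →ₗ[F] P') (σ : B →ₗ[F] C ⊗[F] P) (ρ : A →ₗ[F] B ⊗[F] Q) :
    LinearMap.lTensor C (LinearMap.rTensor Q f) ∘ₗ coComp σ ρ =
      coComp (LinearMap.lTensor C f ∘ₗ σ) ρ := by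
  ext a
  simp only [coComp, LinearMap.comp_apply]
  induction ρ a with
  | zero => simp
  | tmul b q =>
    simp only [LinearMap.rTensor_tmul, LinearMap.comp_apply]
    induction σ b with
    | zero => simp
    | tmul c p => simp
    | add a b ha hb => simp only [map_add, TensorProduct.add_tmul, ha, hb]
  | add a b ha hb => simp only [map_add, ha, hb]

theorem lTensor_lTensor_coComp (g : Q →ₗ[F] Q') (σ : B →ₗ[F] C ⊗[F] P) (ρ : A →ₗ[F] B ⊗[F] Q) :
    LinearMap.lTensor C (LinearMap.lTensor P g) ∘ₗ coComp σ ρ =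
      coComp σ (LinearMap.lTensor B g ∘ₗ ρ) := by
  ext a
  simp only [coComp, LinearMap.comp_apply]
  induction ρ a with
  | zero => simp
  | tmul b q =>
    simp only [LinearMap.rTensor_tmul, LinearMap.lTensor_tmul]
    induction σ b with
    | zero => simp
    | tmul c p => simp
    | add a b ha hb => simp only [map_add, TensorProduct.add_tmul, ha, hb]
  | add a b ha hb => simp only [map_add, ha, hb]

theorem coComp_assoc (τ : C →ₗ[F] D ⊗[F] R) (σ : B →ₗ[F] C ⊗[F] P) (ρ : A →ₗ[F] B ⊗[F] Q) :
    LinearMap.lTensor D (TensorProduct.assoc F R P Q).toLinearMap ∘ₗ coComp (coComp τ σ) ρ =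
      coComp τ (coComp σ ρ) := by
  ext a
  simp only [coComp, LinearMap.comp_apply]
  induction ρ a with
  | zero => simp
  | tmul b q =>
    simp only [LinearMap.rTensor_tmul, LinearMap.comp_apply]
    induction σ b with
    | zero => simp
    | tmul c p =>
      simp only [LinearMap.rTensor_tmul, LinearEquiv.coe_coe, TensorProduct.assoc_tmul]
      induction τ c with
      | zero => simp
      | tmul d r => simp
      | add a b ha hb => simp only [map_add, TensorProduct.add_tmul, ha, hb]
    | add a b ha hb => simp only [map_add, TensorProduct.add_tmul, ha, hb]
  | add a b ha hb => simp only [map_add, ha, hb]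

theorem coComp_unitMap_left (ρ : A →ₗ[F] B ⊗[F] Q) :
    coComp (unitMap F B P) ρ =
      LinearMap.lTensor B (TensorProduct.mk F P Q 1) ∘ₗ ρ := by
  ext a
  simp only [coComp, LinearMap.comp_apply]
  induction ρ a with
  | zero => simp
  | tmul b q => simp
  | add a b ha hb => simp only [map_add, ha, hb]

theorem coComp_unitMap_right (σ : A →ₗ[F] B ⊗[F] P) :
    coComp σ (unitMap F A Q) =
      LinearMap.lTensor B ((TensorProduct.mk F P Q).flip 1) ∘ₗ σ := by
  ext a
  simp only [coComp, LinearMap.comp_apply, unitMap_apply, LinearMap.rTensor_tmul]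
  induction σ a with
  | zero => simp
  | tmul b q => simp
  | add a b ha hb => simp only [map_add, TensorProduct.add_tmul, ha, hb]

/-- This reads `coComp` as a convolution product over `P ⊗ Q`, so that it can be inverted factor by
factor. -/
theorem coComp_eq_extend (σ : A →ₗ[F] A ⊗[F] P) (ρ : A →ₗ[F] A ⊗[F] Q) :
    coComp σ ρ =
      extend (LinearMap.lTensor A
        (Algebra.TensorProduct.includeLeft : P →ₐ[F] P ⊗[F] Q).toLinearMap ∘ₗ σ) ∘ₗ
        LinearMap.lTensor A
          (Algebra.TensorProduct.includeRight : Q →ₐ[F] P ⊗[F] Q).toLinearMap ∘ₗ ρ := by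
  ext a
  simp only [coComp, LinearMap.comp_apply]
  induction ρ a with
  | zero => simp
  | tmul b q =>
    simp only [LinearMap.rTensor_tmul, LinearMap.lTensor_tmul, extend_tmul, LinearMap.comp_apply]
    induction σ b with
    | zero => simp
    | tmul c p => simp
    | add a b ha hb => simp only [map_add, TensorProduct.add_tmul, ha, hb]
  | add a b ha hb => simp only [map_add, ha, hb]

theorem lTensor_comm_coComp (σ : A →ₗ[F] A ⊗[F] P) (ρ : A →ₗ[F] A ⊗[F] Q) :
    LinearMap.lTensor A (TensorProduct.comm F P Q).toLinearMap ∘ₗ coComp σ ρ =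
      extend (LinearMap.lTensor A
        (Algebra.TensorProduct.includeRight : P →ₐ[F] Q ⊗[F] P).toLinearMap ∘ₗ σ) ∘ₗ
        LinearMap.lTensor A
          (Algebra.TensorProduct.includeLeft : Q →ₐ[F] Q ⊗[F] P).toLinearMap ∘ₗ ρ := by
  ext a
  simp only [coComp, LinearMap.comp_apply]
  induction ρ a with
  | zero => simp
  | tmul b q =>
    simp only [LinearMap.rTensor_tmul, LinearMap.lTensor_tmul, extend_tmul, LinearMap.comp_apply]
    induction σ b with
    | zero => simp
    | tmul c p => simp
    | add a b ha hb => simp only [map_add, TensorProduct.add_tmul, ha, hb]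
  | add a b ha hb => simp only [map_add, ha, hb]

theorem extend_comp_map (φ : R →ₐ[F] R') {ρ σ : A →ₗ[F] A ⊗[F] R}
    (h : extend ρ ∘ₗ σ = unitMap F A R) :
    extend (LinearMap.lTensor A φ.toLinearMap ∘ₗ ρ) ∘ₗ (LinearMap.lTensor A φ.toLinearMap ∘ₗ σ) =
      unitMap F A R' := by
  ext a
  have := LinearMap.congr_fun h a
  simp only [LinearMap.comp_apply] at this
  simp only [LinearMap.comp_apply]
  rw [extend_map, this]
  simp

theorem extend_comp_comp {ρ σ ρ' σ' : A →ₗ[F] A ⊗[F] R} (h : extend ρ ∘ₗ σ = unitMap F A R)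
    (h' : extend ρ' ∘ₗ σ' = unitMap F A R) :
    extend (extend ρ ∘ₗ ρ') ∘ₗ (extend σ' ∘ₗ σ) = unitMap F A R := by
  rw [extend_extend, LinearMap.comp_assoc, ← LinearMap.comp_assoc _ (extend σ'), ← extend_extend,
    h', extend_unitMap, LinearMap.id_comp, h]

theorem extend_comp_lTensor (S : R →ₗ[F] R) (ρ σ : A →ₗ[F] A ⊗[F] R) :
    extend ρ ∘ₗ LinearMap.lTensor A S ∘ₗ σ =
      LinearMap.lTensor A (LinearMap.mul' F R ∘ₗ LinearMap.lTensor R S) ∘ₗ coComp ρ σ := by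
  rw [LinearMap.lTensor_comp, LinearMap.comp_assoc, lTensor_lTensor_coComp]
  rfl

theorem extend_lTensor_comp (S : R →ₗ[F] R) (ρ σ : A →ₗ[F] A ⊗[F] R) :
    extend (LinearMap.lTensor A S ∘ₗ ρ) ∘ₗ σ =
      LinearMap.lTensor A (LinearMap.mul' F R ∘ₗ LinearMap.rTensor R S) ∘ₗ coComp ρ σ := by
  rw [LinearMap.lTensor_comp, LinearMap.comp_assoc, lTensor_rTensor_coComp]
  rfl

end CoComp

/-! ### Points from the trivial coaction, from tensor squares and from Hopf coactions -/

section Constructions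

variable {F : Type u} [Field F] {A : Type v} [AddCommGroup A] [Module F A]
  {Ω : Type w} {s t : Ω → ℕ} {op : Structure F s t A} {V : Subalgebra F (Module.End F A)}

theorem isPoint_unitMap (R : Type y) [CommRing R] [Algebra F R] :
    IsPoint op V LinearMap.id (unitMap F A R) where
  map_one := rfl
  map_mul a b := mul_comm a b
  coef_eq_zero a α h := by
    have : α a = 0 := h 1 V.one_mem
    simp [this]
  comeasuring := isComeasuring_unitMap
  right_inv := by simp [extend_unitMap]
  left_inv := by simp [extend_unitMap]

/-- The source of the comultiplication. The flip is needed because the inverse of a convolution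
product is the product of the inverses in reverse order. -/
theorem IsPoint.tensor {R : Type y} [Ring R] [Algebra F R] {S : R →ₗ[F] R}
    {ρ : A →ₗ[F] A ⊗[F] R} (h : IsPoint op V S ρ) :
    IsPoint op V (TensorProduct.map S S ∘ₗ (TensorProduct.comm F R R).toLinearMap)
      (coComp ρ ρ) := by
  have hS : LinearMap.lTensor A
      (TensorProduct.map S S ∘ₗ (TensorProduct.comm F R R).toLinearMap) ∘ₗ coComp ρ ρ =
      LinearMap.lTensor A (TensorProduct.comm F R R).toLinearMap ∘ₗ
        coComp (LinearMap.lTensor A S ∘ₗ ρ) (LinearMap.lTensor A S ∘ₗ ρ) := by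
    rw [← lTensor_lTensor_coComp, ← lTensor_rTensor_coComp, ← LinearMap.comp_assoc,
      ← LinearMap.comp_assoc, ← LinearMap.lTensor_comp, ← LinearMap.lTensor_comp]
    congr 2
    ext a b
    simp
  refine ⟨?_, ?_, ?_, h.comeasuring.coComp h.comeasuring, ?_, ?_⟩
  · simp [Algebra.TensorProduct.one_def, h.map_one]
  · intro a b
    induction a with
    | zero => simp
    | add a a' ha ha' => rw [add_mul, map_add, ha, ha', map_add, mul_add]
    | tmul a a' =>
      induction b with
      | zero => simp
      | add b b' hb hb' => rw [mul_add, map_add, hb, hb', map_add, add_mul]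
      | tmul b b' => simp [h.map_mul]
  · intro a α hα
    have h1 : coef α (coComp ρ ρ a) = LinearMap.rTensor R (coef α ∘ₗ ρ) (ρ a) := by
      simp only [coComp, LinearMap.comp_apply]
      induction ρ a with
      | zero => simp
      | tmul b q =>
        simp only [LinearMap.rTensor_tmul, LinearMap.comp_apply]
        induction ρ b with
        | zero => simp
        | tmul c p => simp [TensorProduct.smul_tmul']
        | add a b ha hb => simp only [map_add, TensorProduct.add_tmul, ha, hb]
      | add a b ha hb => simp only [map_add, ha, hb]
    rw [h1]
    apply eq_zero_of_coef
    intro β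
    have h2 : coef β ∘ₗ LinearMap.rTensor R (coef α ∘ₗ ρ) = coef (β ∘ₗ coef α ∘ₗ ρ) := by
      apply TensorProduct.ext'
      intro a r
      simp
    rw [← LinearMap.comp_apply, h2]
    apply h.coef_eq_zero
    intro v hv
    rw [LinearMap.comp_apply, LinearMap.comp_apply, h.coef_eq_zero (v a) α, map_zero]
    intro v' hv'
    -- Here `V` has to be closed under multiplication: `V(Va) ⊆ Va`.
    exact hα (v' * v) (V.mul_mem hv' hv)
  · rw [hS, lTensor_comm_coComp, coComp_eq_extend]
    exact extend_comp_comp (extend_comp_map _ h.right_inv) (extend_comp_map _ h.right_inv)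
  · rw [hS, lTensor_comm_coComp, coComp_eq_extend]
    exact extend_comp_comp (extend_comp_map _ h.left_inv) (extend_comp_map _ h.left_inv)

theorem IsCoaction.lTensor_counit {H : Type y} [Ring H] [Bialgebra F H] {ρ : A →ₗ[F] A ⊗[F] H}
    (h : IsCoaction op ρ) :
    LinearMap.lTensor A (Coalgebra.counit (R := F) (A := H)) ∘ₗ ρ = unitMap F A F := by
  ext a
  apply (TensorProduct.rid F A).injective
  simpa using h.counit a

theorem IsCoaction.isPoint {H : Type y} [Ring H] [HopfAlgebra F H] {ρ : A →ₗ[F] A ⊗[F] H}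
    (h : IsCoaction op ρ) (hV : cosupp ρ ≤ Subalgebra.toSubmodule V) :
    IsPoint op V (HopfAlgebra.antipode F) ρ := by
  have hco : coComp ρ ρ = LinearMap.lTensor A (Coalgebra.comul (R := F) (A := H)) ∘ₗ ρ := h.coassoc
  have hcu : LinearMap.lTensor A (Algebra.linearMap F H ∘ₗ Coalgebra.counit) ∘ₗ ρ =
      unitMap F A H := by
    rw [LinearMap.lTensor_comp, LinearMap.comp_assoc, h.lTensor_counit]
    ext a
    simp
  refine ⟨HopfAlgebra.antipode_one, HopfAlgebra.antipode_mul_antidistrib, ?_, h.comeasuring, ?_, ?_⟩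
  · intro a α hα
    rw [← Module.forall_dual_apply_eq_zero_iff F]
    intro f
    rw [coef_coactDual]
    exact hα _ (hV ⟨f, rfl⟩)
  · rw [extend_comp_lTensor, hco, ← LinearMap.comp_assoc, ← LinearMap.lTensor_comp,
      LinearMap.comp_assoc, HopfAlgebra.mul_antipode_lTensor_comul, hcu]
  · rw [extend_lTensor_comp, hco, ← LinearMap.comp_assoc, ← LinearMap.lTensor_comp,
      LinearMap.comp_assoc, HopfAlgebra.mul_antipode_rTensor_comul, hcu]

end Constructions

/-! ### The bialgebra structure on the universal algebra -/

namespace Univ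

variable {F : Type u} [Field F] {A : Type v} [AddCommGroup A] [Module F A]
  {Ω : Type w} {s t : Ω → ℕ} {op : Structure F s t A} {V : Subalgebra F (Module.End F A)}

/-- The homomorphism classifying a pair that satisfies `IsPoint`. -/
def lift {R : Type (max u v x)} [Ring R] [Algebra F R] {S : R →ₗ[F] R} {ρ : A →ₗ[F] A ⊗[F] R}
    (h : IsPoint op V S ρ) : Univ.{u, v, w, x} op V →ₐ[F] R :=
  eval ⟨R, S, ρ, h⟩

theorem lift_anti {R : Type (max u v x)} [Ring R] [Algebra F R] {S : R →ₗ[F] R}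
    {ρ : A →ₗ[F] A ⊗[F] R} (h : IsPoint op V S ρ) (a : Univ.{u, v, w, x} op V) :
    lift h (anti op V a) = S (lift h a) :=
  eval_anti ⟨R, S, ρ, h⟩ a

theorem lift_coact (hV : PointwiseFiniteDimensional (Subalgebra.toSubmodule V))
    {R : Type (max u v x)} [Ring R] [Algebra F R] {S : R →ₗ[F] R}
    {ρ : A →ₗ[F] A ⊗[F] R} (h : IsPoint op V S ρ) :
    LinearMap.lTensor A (lift.{u, v, w, x} h).toLinearMap ∘ₗ coact op hV = ρ :=
  eval_coact hV ⟨R, S, ρ, h⟩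

variable (op V) in
/-- The counit of the universal algebra. -/
def counit : Univ.{u, v, w, x} op V →ₐ[F] F :=
  (ULift.algEquiv (R := F) : ULift.{max v x} F ≃ₐ[F] F).toAlgHom.comp
    (lift (isPoint_unitMap (ULift.{max v x} F)))

theorem counit_anti (a : Univ.{u, v, w, x} op V) : counit op V (anti op V a) = counit op V a := by
  simp only [counit, AlgHom.comp_apply, lift_anti, LinearMap.id_apply]

variable (hV : PointwiseFiniteDimensional (Subalgebra.toSubmodule V))

theorem lTensor_counit_coact :
    LinearMap.lTensor A (counit.{u, v, w, x} op V).toLinearMap ∘ₗ coact op hV = unitMap F A F := by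
  rw [counit, AlgHom.comp_toLinearMap, LinearMap.lTensor_comp, LinearMap.comp_assoc, lift_coact]
  ext a
  simp

variable (op) in
/-- The comultiplication of the universal algebra. -/
def comul : Univ.{u, v, w, x} op V →ₐ[F] Univ.{u, v, w, x} op V ⊗[F] Univ.{u, v, w, x} op V :=
  lift (isPoint hV).tensor

theorem comul_anti (a : Univ.{u, v, w, x} op V) :
    comul op hV (anti op V a) =
      TensorProduct.map (anti op V) (anti op V) (TensorProduct.comm F _ _ (comul op hV a)) :=
  lift_anti (isPoint hV).tensor a

theorem lTensor_comul_coact :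
    LinearMap.lTensor A (comul.{u, v, w, x} op hV).toLinearMap ∘ₗ coact op hV =
      coComp (coact op hV) (coact op hV) :=
  lift_coact hV (isPoint hV).tensor

/-- The bialgebra structure on the universal algebra. -/
abbrev bialgebra : Bialgebra F (Univ.{u, v, w, x} op V) :=
  Bialgebra.ofAlgHom (comul op hV) (counit op V)
    (algHom_ext hV (by
      have h1 : LinearMap.lTensor A (Algebra.TensorProduct.map (comul op hV)
          (AlgHom.id F (Univ.{u, v, w, x} op V))).toLinearMap ∘ₗ
          coComp (coact op hV) (coact op hV) = _ :=
        lTensor_rTensor_coComp (comul op hV).toLinearMap (coact op hV) (coact op hV)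
      have h2 : LinearMap.lTensor A (Algebra.TensorProduct.map
          (AlgHom.id F (Univ.{u, v, w, x} op V)) (comul op hV)).toLinearMap ∘ₗ
          coComp (coact op hV) (coact op hV) = _ :=
        lTensor_lTensor_coComp (comul op hV).toLinearMap (coact op hV) (coact op hV)
      simp only [AlgHom.comp_toLinearMap, LinearMap.lTensor_comp, LinearMap.comp_assoc,
        lTensor_comul_coact]
      rw [h1, h2, lTensor_comul_coact]
      exact coComp_assoc _ _ _))
    (algHom_ext hV (by
      have h1 : LinearMap.lTensor A (Algebra.TensorProduct.map (counit op V)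
          (AlgHom.id F (Univ.{u, v, w, x} op V))).toLinearMap ∘ₗ
          coComp (coact op hV) (coact op hV) = _ :=
        lTensor_rTensor_coComp (counit op V).toLinearMap (coact op hV) (coact op hV)
      simp only [AlgHom.comp_toLinearMap, LinearMap.lTensor_comp, LinearMap.comp_assoc,
        lTensor_comul_coact]
      rw [h1, lTensor_counit_coact, coComp_unitMap_left]
      rfl))
    (algHom_ext hV (by
      have h1 : LinearMap.lTensor A (Algebra.TensorProduct.map
          (AlgHom.id F (Univ.{u, v, w, x} op V)) (counit op V)).toLinearMap ∘ₗ
          coComp (coact op hV) (coact op hV) = _ :=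
        lTensor_lTensor_coComp (counit op V).toLinearMap (coact op hV) (coact op hV)
      simp only [AlgHom.comp_toLinearMap, LinearMap.lTensor_comp, LinearMap.comp_assoc,
        lTensor_comul_coact]
      rw [h1, lTensor_counit_coact, coComp_unitMap_right]
      rfl))

end Univ

/-! ### Antipode identities for an anti-endomorphism -/

section AntiEndomorphism

variable {F R : Type*} [Field F] [Ring R] [Algebra F R] {S : R →ₗ[F] R}

/-- Since `S` reverses products, the expression for `x` sits in the middle of that for `x * y`;
being a scalar, it can be pulled out. Hence the antipode identity passes to products. -/
theorem mul'_rTensor_mul (hS : ∀ a b, S (a * b) = S b * S a) {x : R ⊗[F] R} {c : F}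
    (hx : LinearMap.mul' F R (LinearMap.rTensor R S x) = algebraMap F R c) (y : R ⊗[F] R) :
    LinearMap.mul' F R (LinearMap.rTensor R S (x * y)) =
      algebraMap F R c * LinearMap.mul' F R (LinearMap.rTensor R S y) := by
  induction y with
  | zero => simp
  | add y y' hy hy' => simp only [mul_add, map_add, hy, hy']
  | tmul v w =>
    have key : LinearMap.mul' F R (LinearMap.rTensor R S (x * v ⊗ₜ[F] w)) =
        S v * LinearMap.mul' F R (LinearMap.rTensor R S x) * w := by
      clear hx
      induction x with
      | zero => simp
      | add x x' hx hx' => simp only [add_mul, mul_add, map_add, hx, hx']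
      | tmul a b => simp [hS, mul_assoc]
    rw [key, hx, ← Algebra.commutes, mul_assoc]
    simp

theorem mul'_lTensor_mul (hS : ∀ a b, S (a * b) = S b * S a) {y : R ⊗[F] R} {c : F}
    (hy : LinearMap.mul' F R (LinearMap.lTensor R S y) = algebraMap F R c) (x : R ⊗[F] R) :
    LinearMap.mul' F R (LinearMap.lTensor R S (x * y)) =
      LinearMap.mul' F R (LinearMap.lTensor R S x) * algebraMap F R c := by
  induction x with
  | zero => simp
  | add x x' hx hx' => simp only [add_mul, map_add, hx, hx']
  | tmul v w =>
    have key : LinearMap.mul' F R (LinearMap.lTensor R S (v ⊗ₜ[F] w * y)) =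
        v * LinearMap.mul' F R (LinearMap.lTensor R S y) * S w := by
      clear hy
      induction y with
      | zero => simp
      | add x x' hx hx' => simp only [add_mul, mul_add, map_add, hx, hx']
      | tmul a b => simp [hS, mul_assoc]
    rw [key, hy, mul_assoc, Algebra.commutes, ← mul_assoc]
    simp

theorem mul'_rTensor_map_comm (hS : ∀ a b, S (a * b) = S b * S a) (z : R ⊗[F] R) :
    LinearMap.mul' F R (LinearMap.rTensor R S
      (TensorProduct.map S S (TensorProduct.comm F R R z))) =
      S (LinearMap.mul' F R (LinearMap.lTensor R S z)) := by
  induction z with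
  | zero => simp
  | add x x' hx hx' => simp only [map_add, hx, hx']
  | tmul a b => simp [hS]

theorem mul'_lTensor_map_comm (hS : ∀ a b, S (a * b) = S b * S a) (z : R ⊗[F] R) :
    LinearMap.mul' F R (LinearMap.lTensor R S
      (TensorProduct.map S S (TensorProduct.comm F R R z))) =
      S (LinearMap.mul' F R (LinearMap.rTensor R S z)) := by
  induction z with
  | zero => simp
  | add x x' hx hx' => simp only [map_add, hx, hx']
  | tmul a b => simp [hS]

end AntiEndomorphism

/-! ### The antipode and the universal property -/

namespace Univ

variable {F : Type u} [Field F] {A : Type v} [AddCommGroup A] [Module F A]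
  {Ω : Type w} {s t : Ω → ℕ} {op : Structure F s t A} {V : Subalgebra F (Module.End F A)}
  (hV : PointwiseFiniteDimensional (Subalgebra.toSubmodule V))

theorem anti_algebraMap (c : F) :
    anti op V (algebraMap F (Univ.{u, v, w, x} op V) c) = algebraMap F _ c := by
  rw [Algebra.algebraMap_eq_smul_one, map_smul, anti_one]

variable (op) in
/-- The elements for which both antipode identities hold. -/
def antipodeSubalgebra : Subalgebra F (Univ.{u, v, w, x} op V) where
  carrier := {a |
    LinearMap.mul' F _ (LinearMap.rTensor _ (anti op V) (comul op hV a)) =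
      algebraMap F _ (counit op V a) ∧
    LinearMap.mul' F _ (LinearMap.lTensor _ (anti op V) (comul op hV a)) =
      algebraMap F _ (counit op V a)}
  mul_mem' {a b} ha hb := by
    constructor
    · rw [map_mul, mul'_rTensor_mul anti_mul ha.1, hb.1, map_mul, map_mul]
    · rw [map_mul, mul'_lTensor_mul anti_mul hb.2, ha.2, map_mul, map_mul]
  add_mem' {a b} ha hb := by
    constructor
    · simp only [map_add, ha.1, hb.1]
    · simp only [map_add, ha.2, hb.2]
  algebraMap_mem' c := by
    simp [Algebra.algebraMap_eq_smul_one, Algebra.TensorProduct.one_def, anti_one]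

/-- On the coefficients of the universal comeasuring, the identities are the two convolution-inverse
axioms. Applying `S` interchanges the left and right identities, which is why both are carried
together. -/
theorem mem_antipodeSubalgebra (a : Univ.{u, v, w, x} op V) : a ∈ antipodeSubalgebra op hV := by
  have hcomul (a : A) := LinearMap.congr_fun (lTensor_comul_coact.{u, v, w, x} (op := op) hV) a
  have hcounit (a : A) := LinearMap.congr_fun (lTensor_counit_coact.{u, v, w, x} (op := op) hV) a
  have hl := (isPoint.{u, v, w, x} (op := op) hV).left_inv
  have hr := (isPoint.{u, v, w, x} (op := op) hV).right_inv
  rw [extend_lTensor_comp] at hl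
  rw [extend_comp_lTensor] at hr
  have hε (α : Module.Dual F A) (a : A) : counit op V (gen.{u, v, w, x} op V α a) = α a := by
    have := congrArg (coef α) (hcounit a)
    simp only [LinearMap.comp_apply, coef_lTensor, coef_coact, unitMap_apply, coef_tmul,
      smul_eq_mul, mul_one] at this
    exact this
  have hΔ (α : Module.Dual F A) (a : A) : comul op hV (gen.{u, v, w, x} op V α a) =
      coef α (coComp (coact op hV) (coact op hV) a) := by
    rw [← hcomul, LinearMap.comp_apply, coef_lTensor, coef_coact]
    rfl
  refine mem_of_gen (E := antipodeSubalgebra op hV) (fun α a => ⟨?_, ?_⟩) (fun a ha => ⟨?_, ?_⟩) a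
  · have := congrArg (coef α) (LinearMap.congr_fun hl a)
    rw [LinearMap.comp_apply, coef_lTensor, ← hΔ, unitMap_apply, coef_tmul] at this
    rw [hε, Algebra.algebraMap_eq_smul_one]
    exact this
  · have := congrArg (coef α) (LinearMap.congr_fun hr a)
    rw [LinearMap.comp_apply, coef_lTensor, ← hΔ, unitMap_apply, coef_tmul] at this
    rw [hε, Algebra.algebraMap_eq_smul_one]
    exact this
  · rw [comul_anti, counit_anti, mul'_rTensor_map_comm anti_mul, ha.2, anti_algebraMap]
  · rw [comul_anti, counit_anti, mul'_lTensor_map_comm anti_mul, ha.1, anti_algebraMap]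

/-- The Hopf algebra structure on the universal algebra. -/
abbrev hopfAlgebra : HopfAlgebra F (Univ.{u, v, w, x} op V) where
  __ := bialgebra hV
  antipode := anti op V
  mul_antipode_rTensor_comul := LinearMap.ext fun a => (mem_antipodeSubalgebra hV a).1
  mul_antipode_lTensor_comul := LinearMap.ext fun a => (mem_antipodeSubalgebra hV a).2

theorem isCoaction :
    letI := hopfAlgebra.{u, v, w, x} (op := op) hV
    IsCoaction op (coact.{u, v, w, x} op hV) :=
  letI := hopfAlgebra.{u, v, w, x} (op := op) hV
  { coassoc := (lTensor_comul_coact hV).symm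
    counit := fun a => by
      have := LinearMap.congr_fun (lTensor_counit_coact.{u, v, w, x} (op := op) hV) a
      refine (congrArg (TensorProduct.rid F A) this).trans ?_
      simp
    comeasuring := (isPoint hV).comeasuring }

/-- The coaction is a point, so it is classified by an algebra map. Compatibility with counit and
comultiplication, as well as uniqueness, only need checking on the universal comeasuring, by
`algHom_ext`. -/
theorem existsUnique_bialgHom {H : Type (max u v x)} [Ring H] [HopfAlgebra F H]
    {ρ : A →ₗ[F] A ⊗[F] H} (hρ : IsCoaction op ρ) (hc : cosupp ρ ≤ Subalgebra.toSubmodule V) :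
    letI := hopfAlgebra.{u, v, w, x} (op := op) hV
    ∃! φ : Univ.{u, v, w, x} op V →ₐc[F] H,
      LinearMap.lTensor A ((φ : Univ.{u, v, w, x} op V →ₐ[F] H).toLinearMap) ∘ₗ coact op hV =
        ρ := by
  let _ := hopfAlgebra.{u, v, w, x} (op := op) hV
  let φ : Univ.{u, v, w, x} op V →ₐ[F] H := lift (hρ.isPoint hc)
  have hφ : LinearMap.lTensor A φ.toLinearMap ∘ₗ coact op hV = ρ := lift_coact hV _
  refine ⟨BialgHom.ofAlgHom φ (algHom_ext hV ?_) (algHom_ext hV ?_), hφ, fun ψ hψ => ?_⟩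
  · rw [AlgHom.comp_toLinearMap, LinearMap.lTensor_comp, LinearMap.comp_assoc, hφ]
    exact hρ.lTensor_counit.trans (lTensor_counit_coact hV).symm
  · have h1 : LinearMap.lTensor A (Algebra.TensorProduct.map φ φ).toLinearMap ∘ₗ
        coComp (coact op hV) (coact op hV) = coComp ρ ρ := by
      have : (Algebra.TensorProduct.map φ φ).toLinearMap =
          LinearMap.lTensor H φ.toLinearMap ∘ₗ LinearMap.rTensor _ φ.toLinearMap := by
        ext a b
        simp
      rw [this, LinearMap.lTensor_comp, LinearMap.comp_assoc, lTensor_rTensor_coComp, hφ,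
        lTensor_lTensor_coComp, hφ]
    rw [AlgHom.comp_toLinearMap, AlgHom.comp_toLinearMap, LinearMap.lTensor_comp,
      LinearMap.lTensor_comp, LinearMap.comp_assoc, LinearMap.comp_assoc, hφ]
    refine Eq.trans ?_ (h1.trans hρ.coassoc)
    exact congrArg _ (lTensor_comul_coact hV)
  · have : (ψ : Univ.{u, v, w, x} op V →ₐ[F] H) = φ := algHom_ext hV (hψ.trans hφ.symm)
    ext a
    exact AlgHom.congr_fun this a

end Univ

/-! ### Cosupports, and the main theorem -/

section Cosupport

variable {F : Type u} [Field F] {A : Type v} [AddCommGroup A] [Module F A]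
  {B : Type y} [AddCommGroup B] [Module F B]

theorem cosupp_map_le {Q Q' : Type*} [AddCommGroup Q] [Module F Q] [AddCommGroup Q'] [Module F Q']
    (φ : Q →ₗ[F] Q') (ρ : A →ₗ[F] B ⊗[F] Q) :
    cosupp (LinearMap.lTensor B φ ∘ₗ ρ) ≤ cosupp ρ := by
  rintro _ ⟨f, rfl⟩
  refine ⟨f ∘ₗ φ, ?_⟩
  ext a
  simp [coactDual, LinearMap.lTensor_comp]

theorem pointwiseFiniteDimensional_cosupp {Q : Type*} [AddCommGroup Q] [Module F Q]
    (ρ : A →ₗ[F] B ⊗[F] Q) : PointwiseFiniteDimensional (cosupp ρ) := by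
  intro a
  obtain ⟨z, hz⟩ := TensorProduct.exists_finset (ρ a)
  have hfin : FiniteDimensional F (Submodule.span F ((fun p : B × Q => p.1) '' (z : Set (B × Q)))) :=
    FiniteDimensional.span_of_finite F (z.finite_toSet.image _)
  refine Submodule.finiteDimensional_of_le
    (S₂ := Submodule.span F ((fun p : B × Q => p.1) '' (z : Set (B × Q)))) ?_
  rintro _ ⟨_, ⟨f, rfl⟩, rfl⟩
  have : coactDual ρ f a = ∑ p ∈ z, f p.2 • p.1 := by
    simp [coactDual, hz]
  rw [LinearMap.applyₗ_apply_apply, this]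
  exact Submodule.sum_mem _ fun p hp =>
    Submodule.smul_mem _ _ (Submodule.subset_span ⟨p, hp, rfl⟩)

variable {Ω : Type w} {s t : Ω → ℕ} {op : Structure F s t A}

/-- The cosupport of a coaction of a bialgebra is a subalgebra. -/
def IsCoaction.cosuppSubalgebra {H : Type x} [Ring H] [Bialgebra F H] {ρ : A →ₗ[F] A ⊗[F] H}
    (h : IsCoaction op ρ) : Subalgebra F (Module.End F A) :=
  (cosupp ρ).toSubalgebra ⟨Coalgebra.counit, by ext a; exact h.counit a⟩ (by
    rintro _ _ ⟨f, rfl⟩ ⟨g, rfl⟩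
    -- Coassociativity turns composition of operators into the convolution product of functionals on
    -- `H`.
    refine ⟨LinearMap.mul' F F ∘ₗ TensorProduct.map f g ∘ₗ Coalgebra.comul, ?_⟩
    ext a
    have hco := LinearMap.congr_fun h.coassoc a
    simp only [LinearMap.comp_apply] at hco
    change TensorProduct.rid F A (LinearMap.lTensor A _ (ρ a)) =
      TensorProduct.rid F A (LinearMap.lTensor A f (ρ
        (TensorProduct.rid F A (LinearMap.lTensor A g (ρ a)))))
    rw [LinearMap.lTensor_comp, LinearMap.lTensor_comp, LinearMap.comp_apply,
      LinearMap.comp_apply, ← hco]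
    induction ρ a with
    | zero => simp
    | add b c hb hc => simp only [map_add, hb, hc]
    | tmul b q =>
      simp only [LinearMap.rTensor_tmul, LinearMap.lTensor_tmul, TensorProduct.rid_tmul, map_smul]
      induction ρ b with
      | zero => simp
      | add b c hb hc => simp only [map_add, TensorProduct.add_tmul, smul_add, hb, hc]
      | tmul c p => simp [smul_smul, mul_comm])

end Cosupport

end OmegaAlg
end

theorem mainTheorem3 (F : Type u) [Field F] (A : Type v) [AddCommGroup A] [Module F A]
    {Ω : Type w} (s t : Ω → ℕ) (op : OmegaAlg.Structure F s t A) :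
    OmegaAlg.UniversalCoactingHopfExists.{u, v, w, max u v x} op (⊤ : Subalgebra F (Module.End F A)) ↔
      OmegaAlg.PointwiseFiniteDimensional
        (Subalgebra.toSubmodule (OmegaAlg.hopfCosuppAlgebra.{u, v, w, max u v x} op)) := by
  constructor
  · rintro ⟨H, _, _, ρ, h⟩ a
    have := OmegaAlg.pointwiseFiniteDimensional_cosupp ρ a
    refine Submodule.finiteDimensional_of_le (Submodule.map_mono (?_ :
      OmegaAlg.hopfCosuppAlgebra.{u, v, w, max u v x} op ≤ h.isCoaction.cosuppSubalgebra))
    apply Algebra.adjoin_le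
    rintro g ⟨H', _, _, ρ', hρ', hg⟩
    obtain ⟨φ, rfl, -⟩ := h.existsUnique H' ρ' hρ' le_top
    exact OmegaAlg.cosupp_map_le _ ρ hg
  · intro hV
    -- Every coaction meets the cosupport bound for the generated algebra, so the object universal
    -- for that algebra is universal without restriction.
    have hle {H : Type (max u v x)} [Ring H] [HopfAlgebra F H] {ρ : A →ₗ[F] A ⊗[F] H}
        (hρ : OmegaAlg.IsCoaction op ρ) :
        OmegaAlg.cosupp ρ ≤ Subalgebra.toSubmodule (OmegaAlg.hopfCosuppAlgebra.{u, v, w, max u v x} op) :=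
      fun g hg => Algebra.subset_adjoin ⟨H, _, _, ρ, hρ, hg⟩
    let _ := OmegaAlg.Univ.hopfAlgebra.{u, v, w, x} (op := op) hV
    exact ⟨OmegaAlg.Univ.{u, v, w, x} op (OmegaAlg.hopfCosuppAlgebra.{u, v, w, max u v x} op), _,
      inferInstance, OmegaAlg.Univ.coact op hV, OmegaAlg.Univ.isCoaction hV, le_top,
      fun H' _ _ ρ' hρ' _ => OmegaAlg.Univ.existsUnique_bialgHom hV hρ' (hle hρ')⟩
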